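/- A noncrossing graph on $n$ vertices is a simple graph on the vertex set $\{1,\dots,n\}$ such that, when the vertices are placed in this order around a circle and the edges are drawn as straight chords, no two edges cross; equivalently, there are no $a<b<c<d$ such that both $ac$ and $bd$ are edges. Let $N_n$ be the number of connected noncrossing graphs on $n$ (labelled) vertices. Then for every integer $n\ge 1$, $$N_n=\frac{2^{2n-1}}{n}\binom{\frac32 n-2}{n-1}-\frac{2^{2n-2}}{n}\binom{\frac32 n-\frac32}{n-1},$$ where $\binom{x}{k}=\frac{x(x-1)\cdots(x-k+1)}{k!}$ denotes the generalized binomial coefficient for rational $x$ and integer $k\ge 0$. -/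

import Mathlib

/-- A graph on the vertices `0, 1, …, n - 1`, placed in this order around a circle with edges drawn
as chords, is noncrossing if no two edges cross. The chords `ac` and `bd` cross in their interiors
exactly when, up to naming, their endpoints interleave as `a < b < c < d`. -/
def SimpleGraph.IsNoncrossing {n : ℕ} (G : SimpleGraph (Fin n)) : Prop :=
  ∀ a b c d : Fin n, a < b → b < c → c < d → ¬ (G.Adj a c ∧ G.Adj b d)

/-- The number `N_n` of connected noncrossing graphs on `n` (labelled) vertices. -/
noncomputable def numConnectedNoncrossing (n : ℕ) : ℕ :=
  Nat.card {G : SimpleGraph (Fin n) // G.Connected ∧ G.IsNoncrossing}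

/-!
Cut a connected noncrossing graph at the largest neighbour of its first vertex: it splits uniquely
into a connected noncrossing graph containing its outer edge (the edge joining the first and the
last vertex) and a connected noncrossing graph on the remaining interval. Deleting the outer edge
from a graph containing it leaves either a connected noncrossing graph without that edge or two
connected noncrossing graphs on complementary intervals. For the generating functions
`F = ∑ N_{n+1} X^n` and `E` of these two classes of graphs this says `F = 1 + X E F` and
`2 X E = F - 1 + X F²`, hence `X F³ + F² - 3 F + 2 = 0`.

With `s = 2 / F - 1` and `v = 1 - s²` the cubic becomes `v = 4 X (1 - v)^(-1/2)`, while
`2 X F = (1 - v)^(1/2) - (1 - v)`. Lagrange inversion applied to `(1 - v)^(1/2)` and to `1 - v`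
yields the two binomial terms.
-/

namespace NoncrossingGraph

section FormalPowerSeries

open PowerSeries

section LagrangeInversion

variable {R : Type*} [CommRing R]

theorem subst_eq_mul_add_C {u : R⟦X⟧} (hu : HasSubst u) (f : R⟦X⟧) :
    f.subst u = u * (mk fun n => coeff (n + 1) f).subst u + C (constantCoeff f) := by
  conv_lhs => rw [eq_X_mul_shift_add_const f, subst_add hu, subst_mul hu, subst_X hu, subst_C]
  rfl

theorem constantCoeff_subst_of_constantCoeff_eq_zero {u : R⟦X⟧} (hu : constantCoeff u = 0)
    (f : R⟦X⟧) : constantCoeff (f.subst u) = constantCoeff f := by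
  rw [subst_eq_mul_add_C (.of_constantCoeff_zero' hu), map_add, map_mul, hu, zero_mul, zero_add,
    constantCoeff_C]

variable {K : Type*} [Field K] [CharZero K]

theorem coeff_derivative_mul_inv_pow {g : K⟦X⟧} (hg : constantCoeff g ≠ 0)
    (n : ℕ) : coeff n (d⁄dX K (X * g) * g⁻¹ ^ (n + 1)) = if n = 0 then 1 else 0 := by
  have hinv : g * g⁻¹ = 1 := PowerSeries.mul_inv_cancel g hg
  have hderiv : d⁄dX K (X * g) = g + X * d⁄dX K g := by
    rw [Derivation.leibniz, derivative_X, smul_eq_mul, smul_eq_mul]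
    ring
  rcases n with _ | m
  · simp [hderiv, hg]
  have hpow : ((m : K⟦X⟧) + 1) * (d⁄dX K (X * g) * g⁻¹ ^ (m + 2)) =
      ((m : K⟦X⟧) + 1) * g⁻¹ ^ (m + 1) - X * d⁄dX K (g⁻¹ ^ (m + 1)) := by
    rw [derivative_pow, derivative_inv', hderiv, Nat.add_sub_cancel]
    push_cast
    linear_combination (m + 1) * g⁻¹ ^ (m + 1) * hinv
  have hcoeff := congrArg (coeff (m + 1)) hpow
  rw [← Nat.cast_succ, ← map_natCast C, map_sub, coeff_C_mul, coeff_C_mul, coeff_succ_X_mul,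
    coeff_derivative, Nat.cast_succ, mul_comm (coeff _ _), sub_self] at hcoeff
  simpa [Nat.cast_add_one_ne_zero] using hcoeff

-- The residue of `f(u) du / u ^ (n + 1)` does not depend on the parameter `u = X * g`; the powers
-- of `X` are cancelled so that no Laurent series is needed.
theorem coeff_subst_mul_derivative_mul_inv_pow {g : K⟦X⟧} (hg : constantCoeff g ≠ 0)
    (f : K⟦X⟧) (n : ℕ) :
    coeff n (f.subst (X * g) * (d⁄dX K (X * g) * g⁻¹ ^ (n + 1))) = coeff n f := by
  have hu : HasSubst (X * g) := .of_constantCoeff_zero' (by simp)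
  have hinv : g * g⁻¹ = 1 := PowerSeries.mul_inv_cancel g hg
  induction n generalizing f with
  | zero =>
    rw [subst_eq_mul_add_C hu, add_mul, map_add, mul_assoc X, mul_assoc X, coeff_zero_X_mul,
      coeff_C_mul, coeff_derivative_mul_inv_pow hg]
    simp
  | succ n ih =>
    have hshift : X * g * (mk fun k => coeff (k + 1) f).subst (X * g) *
        (d⁄dX K (X * g) * g⁻¹ ^ (n + 2)) =
        X * ((mk fun k => coeff (k + 1) f).subst (X * g) * (d⁄dX K (X * g) * g⁻¹ ^ (n + 1))) := by
      rw [pow_succ _ (n + 1)]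
      linear_combination X * (mk fun k => coeff (k + 1) f).subst (X * g) * d⁄dX K (X * g) *
        g⁻¹ ^ (n + 1) * hinv
    rw [subst_eq_mul_add_C hu, add_mul, map_add, hshift, coeff_succ_X_mul, ih, coeff_C_mul,
      coeff_derivative_mul_inv_pow hg, if_neg n.succ_ne_zero, mul_zero, add_zero, coeff_mk]

theorem lagrange_inversion {u φ : K⟦X⟧} (hu : u = X * φ.subst u)
    (hφ : constantCoeff φ ≠ 0) (f : K⟦X⟧) (n : ℕ) :
    (n + 1) * coeff (n + 1) (f.subst u) = coeff n (d⁄dX K f * φ ^ (n + 1)) := by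
  have hu0 : constantCoeff u = 0 := by rw [hu]; simp
  have hsubst : HasSubst u := .of_constantCoeff_zero' hu0
  have hg : constantCoeff (φ.subst u) ≠ 0 := by
    rwa [constantCoeff_subst_of_constantCoeff_eq_zero hu0]
  have hpow : (φ.subst u) ^ (n + 1) * (φ.subst u)⁻¹ ^ (n + 1) = 1 := by
    rw [← mul_pow, PowerSeries.mul_inv_cancel _ hg, one_pow]
  have key := coeff_subst_mul_derivative_mul_inv_pow hg (d⁄dX K f * φ ^ (n + 1)) n
  rw [← hu, subst_mul hsubst, subst_pow hsubst] at key
  rw [← key, mul_comm, ← coeff_derivative, derivative_subst hsubst]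
  congr 1
  linear_combination -(d⁄dX K f).subst u * d⁄dX K u * hpow

end LagrangeInversion

section OneSubPow

variable {R : Type*} [CommRing R] [BinomialRing R]

/-- The formal power `(1 - X) ^ r`. -/
noncomputable def oneSubPow (r : R) : R⟦X⟧ := rescale (-1) (binomialSeries R r)

theorem constantCoeff_oneSubPow (r : R) : constantCoeff (oneSubPow r) = 1 := by
  simp [oneSubPow, ← coeff_zero_eq_constantCoeff_apply]

theorem oneSubPow_zero : oneSubPow (0 : R) = 1 := by
  simp [oneSubPow]

theorem oneSubPow_one : oneSubPow (1 : R) = 1 - X := by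
  have h := binomialSeries_nat (R := R) (A := R) 1
  rw [Nat.cast_one, pow_one] at h
  simp [oneSubPow, h, sub_eq_add_neg]

theorem oneSubPow_add (r s : R) : oneSubPow (r + s) = oneSubPow r * oneSubPow s := by
  simp only [oneSubPow, binomialSeries_add, map_mul]

theorem oneSubPow_pow (r : R) (n : ℕ) : oneSubPow r ^ n = oneSubPow (n * r) := by
  induction n with
  | zero => simp [oneSubPow_zero]
  | succ n ih => rw [pow_succ, ih, ← oneSubPow_add, Nat.cast_succ, add_one_mul]

theorem coeff_oneSubPow_neg (r : R) (n : ℕ) :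
    coeff n (oneSubPow (-r)) = Ring.choose (r + n - 1) n := by
  rw [oneSubPow, coeff_rescale, binomialSeries_coeff, Ring.choose_neg, smul_eq_mul, mul_one,
    Units.smul_def, zsmul_eq_mul, Int.cast_negOnePow_natCast, ← mul_assoc, ← mul_pow]
  simp

theorem derivative_oneSubPow (r : R) :
    d⁄dX R (oneSubPow r) = -C r * oneSubPow (r - 1) := by
  ext n
  have hchoose := Ring.choose_smul_choose r (Nat.le_add_left 1 n)
  rw [Nat.choose_one_right, Ring.choose_one_right, Nat.add_sub_cancel, nsmul_eq_mul] at hchoose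
  push_cast at hchoose
  rw [coeff_derivative, ← map_neg, coeff_C_mul, oneSubPow, oneSubPow, coeff_rescale, coeff_rescale,
    binomialSeries_coeff, binomialSeries_coeff, smul_eq_mul, smul_eq_mul, pow_succ]
  linear_combination -(-1) ^ n * hchoose

theorem subst_oneSubPow_one {v : R⟦X⟧} (hv : HasSubst v) :
    (oneSubPow (1 : R)).subst v = 1 - v := by
  rw [oneSubPow_one, ← coe_substAlgHom hv, map_sub, map_one, coe_substAlgHom, subst_X hv]

theorem subst_oneSubPow_neg_mul_subst_oneSubPow {v : R⟦X⟧} (hv : HasSubst v) (r : R) :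
    (oneSubPow (-r)).subst v * (oneSubPow r).subst v = 1 := by
  rw [← subst_mul hv, ← oneSubPow_add, neg_add_cancel, oneSubPow_zero, ← coe_substAlgHom hv,
    map_one]

end OneSubPow

section OneSubPowSubst

variable {K : Type*} [Field K] [CharZero K]

theorem succ_mul_coeff_succ_subst_oneSubPow {a b c : K} (hc : c ≠ 0) {v : K⟦X⟧}
    (hv : v = X * (C c * oneSubPow a).subst v) (n : ℕ) :
    (n + 1) * coeff (n + 1) ((oneSubPow b).subst v) =
      -b * c ^ (n + 1) * Ring.choose (n - b - a * (n + 1)) n := by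
  have hφ : constantCoeff (C c * oneSubPow a) ≠ 0 := by
    rwa [map_mul, constantCoeff_C, constantCoeff_oneSubPow, mul_one]
  have hprod : d⁄dX K (oneSubPow b) * (C c * oneSubPow a) ^ (n + 1) =
      C (-b * c ^ (n + 1)) * oneSubPow (-(1 - b - a * (n + 1))) := by
    rw [derivative_oneSubPow, mul_pow, oneSubPow_pow, map_mul, map_neg, map_pow,
      show -(1 - b - a * (n + 1)) = b - 1 + ((n + 1 : ℕ) : K) * a by push_cast; ring,
      oneSubPow_add]
    ring
  rw [lagrange_inversion hv hφ, hprod, coeff_C_mul, coeff_oneSubPow_neg]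
  congr 2
  ring

theorem constantCoeff_eq_zero_of_sq_eq {R : Type*} [CommRing R] {s v : R⟦X⟧}
    (hs : constantCoeff s = 1) (hsv : s ^ 2 = 1 - v) : constantCoeff v = 0 := by
  rw [← sub_sub_cancel 1 v, ← hsv, map_sub, map_one, map_pow, hs, one_pow, sub_self]

theorem subst_oneSubPow_half {s v : K⟦X⟧} (hs : constantCoeff s = 1) (hsv : s ^ 2 = 1 - v) :
    (oneSubPow (1 / 2 : K)).subst v = s := by
  have hv0 : constantCoeff v = 0 := constantCoeff_eq_zero_of_sq_eq hs hsv
  have hsubst : HasSubst v := .of_constantCoeff_zero' hv0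
  have hsq : (oneSubPow (1 / 2 : K)).subst v ^ 2 = s ^ 2 := by
    rw [hsv, ← subst_oneSubPow_one hsubst, ← subst_pow hsubst, oneSubPow_pow]
    norm_num
  refine (sq_eq_sq_iff_eq_or_eq_neg.mp hsq).resolve_right fun hneg => ?_
  have h := congrArg constantCoeff hneg
  rw [constantCoeff_subst_of_constantCoeff_eq_zero hv0, constantCoeff_oneSubPow, map_neg, hs] at h
  norm_num at h

theorem eq_X_mul_subst_oneSubPow_neg_half {s v : K⟦X⟧} (hs : constantCoeff s = 1)
    (hsv : s ^ 2 = 1 - v) (hvs : v * s = 4 * X) :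
    v = X * (C 4 * oneSubPow (-(1 / 2) : K)).subst v := by
  have hv : HasSubst v := .of_constantCoeff_zero' (constantCoeff_eq_zero_of_sq_eq hs hsv)
  have hinv := subst_oneSubPow_neg_mul_subst_oneSubPow hv (1 / 2)
  rw [subst_oneSubPow_half hs hsv] at hinv
  rw [map_ofNat C 4, ← coe_substAlgHom hv, map_mul, map_ofNat, coe_substAlgHom]
  linear_combination (oneSubPow (-(1 / 2) : K)).subst v * hvs - v * hinv

theorem sub_sq_eq_of_cubic {F s : K⟦X⟧} (hF : X * F ^ 3 + F ^ 2 - 3 * F + 2 = 0)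
    (hs : (1 + s) * F = 2) : s - s ^ 2 = 2 * (X * F) := by
  have hF0 : F ≠ 0 := by
    rintro rfl
    simpa [map_ofNat constantCoeff] using congrArg constantCoeff hs
  refine mul_right_cancel₀ (pow_ne_zero 2 hF0) ?_
  linear_combination (3 * F - (1 + s) * F - 2) * hs - 2 * hF

theorem succ_mul_coeff_of_cubic {F : K⟦X⟧} (hF : X * F ^ 3 + F ^ 2 - 3 * F + 2 = 0)
    (hF0 : constantCoeff F = 1) (n : ℕ) :
    2 * ((n + 1) * coeff n F) = 4 ^ (n + 1) * Ring.choose (3 * n / 2 - 1 / 2 : K) n -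
      1 / 2 * 4 ^ (n + 1) * Ring.choose (3 * n / 2 : K) n := by
  obtain ⟨s, hsF⟩ : ∃ s, (1 + s) * F = 2 :=
    ⟨2 * F⁻¹ - 1, by linear_combination 2 * PowerSeries.inv_mul_cancel F (by simp [hF0])⟩
  have hs : constantCoeff s = 1 := by
    have h := congrArg constantCoeff hsF
    rw [map_mul, map_add, map_one, hF0, map_ofNat] at h
    linear_combination h
  have hXF : s - s ^ 2 = 2 * (X * F) := sub_sq_eq_of_cubic hF hsF
  obtain ⟨v, hsv⟩ : ∃ v, s ^ 2 = 1 - v := ⟨1 - s ^ 2, (sub_sub_cancel 1 _).symm⟩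
  have hvs : v * s = 4 * X := by
    linear_combination (1 + s) * hXF + 2 * X * hsF + s * hsv
  have hv := eq_X_mul_subst_oneSubPow_neg_half hs hsv hvs
  have hF' : 2 * (X * F) = (oneSubPow (1 / 2 : K)).subst v - (oneSubPow (1 : K)).subst v := by
    rw [subst_oneSubPow_half hs hsv, subst_oneSubPow_one
      (.of_constantCoeff_zero' (constantCoeff_eq_zero_of_sq_eq hs hsv)), ← hsv, hXF]
  have hcoeff := congrArg (coeff (n + 1)) hF'
  rw [← map_ofNat C 2, coeff_C_mul, coeff_succ_X_mul, map_sub] at hcoeff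
  have hfour : (4 : K) ≠ 0 := by norm_num
  have hhalf := succ_mul_coeff_succ_subst_oneSubPow hfour hv (b := 1 / 2) n
  have hone := succ_mul_coeff_succ_subst_oneSubPow hfour hv (b := 1) n
  rw [show (n - 1 / 2 - -(1 / 2) * (n + 1) : K) = 3 * n / 2 by ring] at hhalf
  rw [show (n - 1 - -(1 / 2) * (n + 1) : K) = 3 * n / 2 - 1 / 2 by ring] at hone
  linear_combination (n + 1) * hcoeff + hhalf - hone

end OneSubPowSubst

end FormalPowerSeries

section Graphs

open Finset (HasAntidiagonal)
open Finset.HasAntidiagonal (antidiagonal)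
open Set SimpleGraph

section Reachability

variable {V : Type*} {G H : SimpleGraph V} {s t : Set V} {k x y : V}

theorem mem_of_reachable (hs : ∀ ⦃u v⦄, G.Adj u v → u ∈ s → v ∈ s) (h : G.Reachable x y)
    (hx : x ∈ s) : y ∈ s := by
  obtain ⟨p⟩ := h
  induction p with
  | nil => exact hx
  | cons huv _ ih => exact ih (hs huv hx)

theorem reachable_of_reachable_sup (hG : G.support ⊆ s) (hH : H.support ⊆ t)
    (hst : s ∩ t ⊆ {k}) (hx : x ∈ s) (h : (G ⊔ H).Reachable x k) : G.Reachable x k := by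
  obtain ⟨p⟩ := h
  induction p with
  | nil => rfl
  | cons huv _ ih =>
    rcases huv with huv | huv
    · exact huv.reachable.trans (ih hst (hG huv.mem_support_right))
    · rw [hst ⟨hx, hH huv.mem_support_left⟩]

theorem support_sup_subset (hG : G.support ⊆ s) (hH : H.support ⊆ s) : (G ⊔ H).support ⊆ s := by
  rintro u ⟨v, huv | huv⟩
  · exact hG huv.mem_support_left
  · exact hH huv.mem_support_left

theorem spanningCoe_induce_adj :
    (G.induce s).spanningCoe.Adj x y ↔ G.Adj x y ∧ x ∈ s ∧ y ∈ s := by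
  simp only [map_adj, comap_adj, Function.Embedding.subtype_apply, Subtype.exists, exists_prop]
  grind

theorem spanningCoe_induce_sup_spanningCoe_induce
    (h : ∀ ⦃u v⦄, G.Adj u v → (u ∈ s ∧ v ∈ s) ∨ (u ∈ t ∧ v ∈ t)) :
    (G.induce s).spanningCoe ⊔ (G.induce t).spanningCoe = G := by
  ext u v
  rw [sup_adj, spanningCoe_induce_adj, spanningCoe_induce_adj, ← and_or_left]
  exact and_iff_left_of_imp (@h u v)

theorem spanningCoe_induce_sup_eq_left (hG : G.support ⊆ s) (hH : H.support ⊆ t)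
    (hst : (s ∩ t).Subsingleton) : ((G ⊔ H).induce s).spanningCoe = G := by
  ext u v
  rw [spanningCoe_induce_adj, sup_adj]
  constructor
  · rintro ⟨huv | huv, hu, hv⟩
    · exact huv
    · exact absurd (hst ⟨hu, hH huv.mem_support_left⟩ ⟨hv, hH huv.mem_support_right⟩) huv.ne
  · exact fun huv => ⟨.inl huv, hG huv.mem_support_left, hG huv.mem_support_right⟩

theorem eq_and_eq_of_sup_eq_sup {G' H' : SimpleGraph V} (hG : G.support ⊆ s) (hH : H.support ⊆ t)
    (hG' : G'.support ⊆ s) (hH' : H'.support ⊆ t) (hst : (s ∩ t).Subsingleton)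
    (h : G ⊔ H = G' ⊔ H') : G = G' ∧ H = H' := by
  constructor
  · rw [← spanningCoe_induce_sup_eq_left hG hH hst, h, spanningCoe_induce_sup_eq_left hG' hH' hst]
  · rw [inter_comm] at hst
    rw [← spanningCoe_induce_sup_eq_left hH hG hst, sup_comm, h, sup_comm,
      spanningCoe_induce_sup_eq_left hH' hG' hst]

theorem injOn_sup_edge : InjOn (· ⊔ edge x y) {G : SimpleGraph V | ¬ G.Adj x y} := by
  intro G hG H hH h
  rw [← sdiff_edge G hG, ← sdiff_edge H hH, ← sup_sdiff_right_self, ← sup_sdiff_right_self (a := H)]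
  exact congrArg (· \ edge x y) h

end Reachability

section Noncrossing

variable {α : Type*} [LinearOrder α] {G H : SimpleGraph α} {s t : Set α} {a b c d u v x y : α}

/-- The noncrossing condition for graphs on an arbitrary linear order. It is imposed on graphs
whose vertex set is an interval of `ℕ`, so that intervals can be cut and joined without
relabelling. -/
def Noncrossing (G : SimpleGraph α) : Prop :=
  ∀ ⦃a b c d⦄, a < b → b < c → c < d → G.Adj a c → ¬ G.Adj b d

theorem Noncrossing.mono (hG : Noncrossing G) (h : H ≤ G) : Noncrossing H :=
  fun _ _ _ _ hab hbc hcd hac hbd => hG hab hbc hcd (h hac) (h hbd)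

theorem Noncrossing.sup (hG : Noncrossing G) (hH : Noncrossing H) (hGs : G.support ⊆ s)
    (hHt : H.support ⊆ t) (hst : ∀ x ∈ s, ∀ y ∈ t, x ≤ y) : Noncrossing (G ⊔ H) := by
  rintro a b c d hab hbc hcd (hac | hac) (hbd | hbd)
  · exact hG hab hbc hcd hac hbd
  · exact hbc.not_ge (hst c (hGs hac.mem_support_right) b (hHt hbd.mem_support_left))
  · exact hab.not_ge (hst b (hGs hbd.mem_support_left) a (hHt hac.mem_support_left))
  · exact hH hab hbc hcd hac hbd

theorem Noncrossing.sup_edge (hG : Noncrossing G) (hGs : G.support ⊆ Icc a b) :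
    Noncrossing (G ⊔ edge a b) := by
  intro p q r s hpq hqr hrs hpr hqs
  simp only [sup_adj, edge_adj] at hpr hqs
  have hmem : ∀ ⦃u v⦄, G.Adj u v → a ≤ u ∧ v ≤ b :=
    fun u v huv => ⟨(hGs huv.mem_support_left).1, (hGs huv.mem_support_right).2⟩
  have := @hG p q r s hpq hqr hrs
  grind

theorem support_sup_edge_subset (hG : G.support ⊆ Icc a b) (hab : a ≤ b) :
    (G ⊔ edge a b).support ⊆ Icc a b := by
  refine support_sup_subset hG ?_
  rintro u ⟨v, huv⟩
  obtain ⟨⟨rfl, -⟩ | ⟨rfl, -⟩, -⟩ := (edge_adj ..).mp huv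
  · exact left_mem_Icc.mpr hab
  · exact right_mem_Icc.mpr hab

theorem Noncrossing.mem_Ioo_of_reachable (hG : Noncrossing G) (huv : G.Adj u v)
    (hux : ¬ G.Reachable u x) (hxy : G.Reachable x y) (hx : x ∈ Ioo u v) : y ∈ Ioo u v := by
  refine (mem_of_reachable (s := {z | ¬ G.Reachable u z ∧ z ∈ Ioo u v}) ?_ hxy ⟨hux, hx⟩).2
  rintro z w hzw ⟨huz, hz⟩
  have huw : ¬ G.Reachable u w := fun h => huz (h.trans hzw.symm.reachable)
  have hwu : w ≠ u := by rintro rfl; exact huw .rfl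
  have hwv : w ≠ v := by rintro rfl; exact huw huv.reachable
  refine ⟨huw, lt_of_not_ge fun hle => ?_, lt_of_not_ge fun hle => ?_⟩
  · exact hG (hle.lt_of_ne hwu) hz.1 hz.2 hzw.symm huv
  · exact hG hz.1 hz.2 (hle.lt_of_ne' hwv) huv hzw

theorem Noncrossing.reachable_of_lt (hG : Noncrossing G) (hab : a < b) (hbc : b < c) (hcd : c < d)
    (hac : G.Reachable a c) (hbd : G.Reachable b d) : G.Reachable a b := by
  by_contra hnot
  suffices ha : a ∈ {x | G.Reachable a x ∧ x ∈ Ioo b d} from ha.2.1.not_gt hab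
  refine mem_of_reachable ?_ hac.symm ⟨hac, hbc, hcd⟩
  rintro x y hxy ⟨hax, hx⟩
  have hay : G.Reachable a y := hax.trans hxy.reachable
  have hxd : ¬ G.Reachable x d := fun h => hnot (hax.trans (h.trans hbd.symm))
  have hyb : ¬ G.Reachable y b := fun h => hnot (hay.trans h)
  have hne_b : y ≠ b := by rintro rfl; exact hyb .rfl
  have hne_d : y ≠ d := by rintro rfl; exact hxd hxy.reachable
  refine ⟨hay, lt_of_not_ge fun hle => ?_, lt_of_not_ge fun hle => ?_⟩
  · have := hG.mem_Ioo_of_reachable hxy.symm hyb hbd ⟨hle.lt_of_ne hne_b, hx.1⟩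
    exact this.2.not_gt hx.2
  · have := hG.mem_Ioo_of_reachable hxy hxd hbd.symm ⟨hx.2, hle.lt_of_ne' hne_d⟩
    exact this.1.not_gt hx.1

/-- `G` is a connected noncrossing graph with vertex set `s`; it is encoded as a graph on the
ambient order all of whose edges lie within `s`. -/
structure IsConnectedNoncrossingOn (s : Set α) (G : SimpleGraph α) : Prop where
  support_subset : G.support ⊆ s
  noncrossing : Noncrossing G
  reachable : ∀ x ∈ s, ∀ y ∈ s, G.Reachable x y

namespace IsConnectedNoncrossingOn

theorem of_reachable (hGs : G.support ⊆ s) (hG : Noncrossing G) (h : ∀ x ∈ s, G.Reachable x c) :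
    IsConnectedNoncrossingOn s G :=
  ⟨hGs, hG, fun x hx y hy => (h x hx).trans (h y hy).symm⟩

theorem sup (hG : IsConnectedNoncrossingOn s G) (hH : IsConnectedNoncrossingOn t H)
    (hst : ∀ x ∈ s, ∀ y ∈ t, x ≤ y) (hcs : c ∈ s) (hct : c ∈ t) :
    IsConnectedNoncrossingOn (s ∪ t) (G ⊔ H) := by
  refine of_reachable (c := c) ?_
    (hG.noncrossing.sup hH.noncrossing hG.support_subset hH.support_subset hst) ?_
  · exact support_sup_subset (hG.support_subset.trans subset_union_left)
      (hH.support_subset.trans subset_union_right)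
  · rintro x (hx | hx)
    · exact (hG.reachable x hx c hcs).mono le_sup_left
    · exact (hH.reachable x hx c hct).mono le_sup_right

theorem spanningCoe_induce (hG : Noncrossing G)
    (hst : s ∩ t ⊆ {c}) (hadj : ∀ ⦃u v⦄, G.Adj u v → (u ∈ s ∧ v ∈ s) ∨ (u ∈ t ∧ v ∈ t))
    (hr : ∀ x ∈ s, G.Reachable x c) : IsConnectedNoncrossingOn s (G.induce s).spanningCoe := by
  have hsupp (s : Set α) : (G.induce s).spanningCoe.support ⊆ s := by
    rintro x ⟨y, hxy⟩
    exact (spanningCoe_induce_adj.mp hxy).2.1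
  refine of_reachable (hsupp s) (hG.mono (spanningCoe_induce_le G s)) fun x hx =>
    reachable_of_reachable_sup (hsupp s) (hsupp t) hst hx ?_
  rw [spanningCoe_induce_sup_spanningCoe_induce hadj]
  exact hr x hx

theorem mem_Icc_of_adj (hG : IsConnectedNoncrossingOn (Icc a b) G)
    (hc : IsGreatest (G.neighborSet a) c) ⦃u v : α⦄ (huv : G.Adj u v) :
    (u ∈ Icc a c ∧ v ∈ Icc a c) ∨ (u ∈ Icc c b ∧ v ∈ Icc c b) := by
  wlog hlt : u < v generalizing u v
  · exact (this huv.symm (huv.ne.lt_of_le' (not_lt.mp hlt))).imp And.symm And.symm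
  have hu := hG.support_subset huv.mem_support_left
  have hv := hG.support_subset huv.mem_support_right
  rcases le_or_gt v c with hvc | hcv
  · exact .inl ⟨⟨hu.1, hlt.le.trans hvc⟩, hv.1, hvc⟩
  rcases le_or_gt c u with hcu | huc
  · exact .inr ⟨⟨hcu, hu.2⟩, hcv.le, hv.2⟩
  rcases hu.1.eq_or_lt with rfl | hau
  · exact absurd (hc.2 huv) hcv.not_ge
  · exact absurd huv (hG.noncrossing hau huc hcv hc.1)

theorem exists_isGreatest_neighborSet [LocallyFiniteOrder α]
    (hG : IsConnectedNoncrossingOn (Icc a b) G) (hab : a < b) :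
    ∃ c, IsGreatest (G.neighborSet a) c := by
  have hfin : (G.neighborSet a).Finite :=
    (finite_Icc a b).subset fun v hv => hG.support_subset hv.mem_support_right
  have hne : (G.neighborSet a).Nonempty := by
    obtain ⟨_ | ⟨hav, _⟩⟩ := hG.reachable a (left_mem_Icc.mpr hab.le) b (right_mem_Icc.mpr hab.le)
    · exact absurd hab (lt_irrefl a)
    · exact ⟨_, hav⟩
  exact (exists_max_image _ id hfin hne).imp fun c hc => ⟨hc.1, fun v hv => hc.2 v hv⟩

theorem exists_eq_sup [LocallyFiniteOrder α] (hG : IsConnectedNoncrossingOn (Icc a b) G)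
    (hab : a < b) : ∃ c ∈ Ioc a b, ∃ G₁ G₂, (IsConnectedNoncrossingOn (Icc a c) G₁ ∧ G₁.Adj a c) ∧
      IsConnectedNoncrossingOn (Icc c b) G₂ ∧ G = G₁ ⊔ G₂ := by
  obtain ⟨c, hc⟩ := hG.exists_isGreatest_neighborSet hab
  have hac : a < c := (hG.support_subset hc.1.mem_support_right).1.lt_of_ne hc.1.ne
  have hcb : c ≤ b := (hG.support_subset hc.1.mem_support_right).2
  have hinter : Icc a c ∩ Icc c b ⊆ {c} := by rw [Icc_inter_Icc_eq_singleton hac.le hcb]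
  have hadj := hG.mem_Icc_of_adj hc
  have hmem : c ∈ Icc a b := ⟨hac.le, hcb⟩
  refine ⟨c, ⟨hac, hcb⟩, (G.induce (Icc a c)).spanningCoe, (G.induce (Icc c b)).spanningCoe,
    ⟨?_, ?_⟩, ?_, (spanningCoe_induce_sup_spanningCoe_induce hadj).symm⟩
  · exact spanningCoe_induce hG.noncrossing hinter hadj fun x hx =>
      hG.reachable x ⟨hx.1, hx.2.trans hcb⟩ c hmem
  · exact spanningCoe_induce_adj.mpr ⟨hc.1, left_mem_Icc.mpr hac.le, right_mem_Icc.mpr hac.le⟩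
  · exact spanningCoe_induce hG.noncrossing (inter_comm _ _ ▸ hinter) (fun u v h => (hadj h).symm)
      fun x hx => hG.reachable x ⟨hac.le.trans hx.1, hx.2⟩ c hmem

theorem sup_edge (hG : IsConnectedNoncrossingOn (Icc a b) G) (hab : a < b) :
    IsConnectedNoncrossingOn (Icc a b) (G ⊔ edge a b) where
  support_subset := support_sup_edge_subset hG.support_subset hab.le
  noncrossing := hG.noncrossing.sup_edge hG.support_subset
  reachable x hx y hy := (hG.reachable x hx y hy).mono le_sup_left

theorem sup_sup_edge (hG : IsConnectedNoncrossingOn (Icc a c) G)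
    (hH : IsConnectedNoncrossingOn (Icc d b) H) (hac : a ≤ c) (hcd : c ⋖ d) (hdb : d ≤ b) :
    IsConnectedNoncrossingOn (Icc a b) (G ⊔ H ⊔ edge a b) := by
  have hab : a < b := hac.trans_lt (hcd.lt.trans_le hdb)
  have hsupp : (G ⊔ H).support ⊆ Icc a b := support_sup_subset
    (hG.support_subset.trans (Icc_subset_Icc_right (hcd.le.trans hdb)))
    (hH.support_subset.trans (Icc_subset_Icc_left (hac.trans hcd.le)))
  have hnc : Noncrossing (G ⊔ H) := hG.noncrossing.sup hH.noncrossing hG.support_subset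
    hH.support_subset fun x hx y hy => hx.2.trans (hcd.le.trans hy.1)
  refine of_reachable (c := a) (support_sup_edge_subset hsupp hab.le) (hnc.sup_edge hsupp)
    fun x hx => ?_
  rcases (le_or_gt d x).symm.imp_left hcd.le_of_lt with hxc | hdx
  · exact (hG.reachable x ⟨hx.1, hxc⟩ a (left_mem_Icc.mpr hac)).mono
      (le_sup_left.trans le_sup_left)
  · have hba : (G ⊔ H ⊔ edge a b).Adj b a := .inr ((edge_adj ..).mpr ⟨.inr ⟨rfl, rfl⟩, hab.ne'⟩)
    exact ((hH.reachable x ⟨hdx, hx.2⟩ b (right_mem_Icc.mpr hdb)).mono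
      (le_sup_right.trans le_sup_left)).trans hba.reachable

theorem reachable_or_reachable_of_sup_edge (h : IsConnectedNoncrossingOn (Icc a b) (G ⊔ edge a b))
    (hx : x ∈ Icc a b) : G.Reachable x a ∨ G.Reachable x b := by
  have hab := hx.1.trans hx.2
  refine mem_of_reachable (s := {y | G.Reachable y a ∨ G.Reachable y b}) ?_
    (h.reachable a (left_mem_Icc.mpr hab) x hx) (.inl .rfl)
  rintro u v (huv | huv) hu
  · exact hu.imp huv.symm.reachable.trans huv.symm.reachable.trans
  · obtain ⟨⟨-, rfl⟩ | ⟨-, rfl⟩, -⟩ := (edge_adj ..).mp huv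
    exacts [.inr .rfl, .inl .rfl]

theorem not_reachable_of_sup_edge (h : IsConnectedNoncrossingOn (Icc a b) (G ⊔ edge a b))
    (hG : ¬ IsConnectedNoncrossingOn (Icc a b) G) : ¬ G.Reachable b a := fun hba =>
  hG <| of_reachable ((support_mono le_sup_left).trans h.support_subset)
    (h.noncrossing.mono le_sup_left) fun _ hx =>
      (h.reachable_or_reachable_of_sup_edge hx).elim id fun hxb => hxb.trans hba

end IsConnectedNoncrossingOn

theorem Noncrossing.exists_covBy [LocallyFiniteOrder α] (hG : Noncrossing G) (hab : a ≤ b)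
    (hor : ∀ x ∈ Icc a b, G.Reachable x a ∨ G.Reachable x b) (hnot : ¬ G.Reachable b a) :
    ∃ c d, a ≤ c ∧ c ⋖ d ∧ d ≤ b ∧ (∀ x ∈ Icc a c, G.Reachable x a) ∧
      ∀ x ∈ Icc d b, G.Reachable x b := by
  obtain ⟨c, ⟨⟨hac, hcb⟩, hca⟩, hmax⟩ := exists_max_image {x ∈ Icc a b | G.Reachable x a} id
    ((finite_Icc a b).subset fun _ hx => hx.1) ⟨a, left_mem_Icc.mpr hab, .rfl⟩
  have hcb' : c < b := hcb.lt_of_ne (by rintro rfl; exact hnot hca)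
  obtain ⟨d, hcd, hdb⟩ := exists_covBy_le_of_lt hcb'
  refine ⟨c, d, hac, hcd, hdb, fun x hx => ?_, fun x hx => ?_⟩
  · by_contra hxa
    have hxb : G.Reachable x b := (hor x ⟨hx.1, hx.2.trans hcb⟩).resolve_left hxa
    have hax : a < x := hx.1.lt_of_ne (by rintro rfl; exact hxa .rfl)
    have hxc : x < c := hx.2.lt_of_ne (by rintro rfl; exact hxa hca)
    exact hxa (hG.reachable_of_lt hax hxc hcb' hca.symm hxb).symm
  · have hx' : x ∈ Icc a b := ⟨hac.trans (hcd.le.trans hx.1), hx.2⟩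
    exact (hor x hx').resolve_left fun hxa => hcd.lt.not_ge (hx.1.trans (hmax x ⟨hx', hxa⟩))

theorem IsConnectedNoncrossingOn.exists_eq_sup_of_sup_edge [LocallyFiniteOrder α]
    (h : IsConnectedNoncrossingOn (Icc a b) (G ⊔ edge a b)) (hab : a ≤ b)
    (hG : ¬ IsConnectedNoncrossingOn (Icc a b) G) :
    ∃ c d, a ≤ c ∧ c ⋖ d ∧ d ≤ b ∧ ∃ G₁ G₂, IsConnectedNoncrossingOn (Icc a c) G₁ ∧
      IsConnectedNoncrossingOn (Icc d b) G₂ ∧ G = G₁ ⊔ G₂ := by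
  have hnc : Noncrossing G := h.noncrossing.mono le_sup_left
  have hnot : ¬ G.Reachable b a := h.not_reachable_of_sup_edge hG
  obtain ⟨c, d, hac, hcd, hdb, hca, hcb⟩ :=
    hnc.exists_covBy hab (fun x hx => h.reachable_or_reachable_of_sup_edge hx) hnot
  have hadj : ∀ ⦃u v⦄, G.Adj u v → (u ∈ Icc a c ∧ v ∈ Icc a c) ∨ (u ∈ Icc d b ∧ v ∈ Icc d b) := by
    intro u v huv
    have hu := h.support_subset (Adj.mem_support_left (.inl huv))
    have hv := h.support_subset (Adj.mem_support_right (.inl huv))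
    have hcross : ∀ ⦃x y⦄, G.Adj x y → x ∈ Icc a c → y ∉ Icc d b := fun x y hxy hx hy =>
      hnot ((hcb y hy).symm.trans (hxy.symm.reachable.trans (hca x hx)))
    have := @hcross u v huv
    have := @hcross v u huv.symm
    have := hcd.le_of_lt (c := u)
    have := hcd.le_of_lt (c := v)
    grind
  have hinter : Icc a c ∩ Icc d b = ∅ := by
    ext x
    simpa using fun _ hxc hdx => absurd hcd.lt (hdx.trans hxc).not_gt
  refine ⟨c, d, hac, hcd, hdb, (G.induce (Icc a c)).spanningCoe, (G.induce (Icc d b)).spanningCoe,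
    .spanningCoe_induce hnc (by simp [hinter]) hadj hca,
    .spanningCoe_induce hnc (by simp [inter_comm, hinter]) (fun u v huv => (hadj huv).symm) hcb,
    (spanningCoe_induce_sup_spanningCoe_induce hadj).symm⟩

end Noncrossing

section Counting

variable {α β : Type*} [LinearOrder α] [LinearOrder β] {G H : SimpleGraph α} {a b c d : α}

theorem IsConnectedNoncrossingOn.isGreatest_neighborSet_sup
    (hG : IsConnectedNoncrossingOn (Icc a c) G) (hac : G.Adj a c)
    (hH : IsConnectedNoncrossingOn (Icc c b) H) : IsGreatest ((G ⊔ H).neighborSet a) c := by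
  refine ⟨.inl hac, ?_⟩
  rintro v (hav | hav)
  · exact (hG.support_subset hav.mem_support_right).2
  · have hca : c ≤ a := (hH.support_subset hav.mem_support_left).1
    exact absurd (hca.antisymm (hG.support_subset hac.mem_support_right).1) hac.ne'

theorem IsConnectedNoncrossingOn.isGreatest_reachable_sup
    (hG : IsConnectedNoncrossingOn (Icc a c) G) (hac : a ≤ c)
    (hH : IsConnectedNoncrossingOn (Icc d b) H) (hcd : c < d) :
    IsGreatest {x | (G ⊔ H).Reachable a x} c := by
  refine ⟨(hG.reachable a (left_mem_Icc.mpr hac) c (right_mem_Icc.mpr hac)).mono le_sup_left,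
    fun x hx => mem_of_reachable (s := Iic c) ?_ hx hac⟩
  rintro u v (huv | huv) hu
  · exact (hG.support_subset huv.mem_support_right).2
  · exact absurd (hcd.trans_le (hH.support_subset huv.mem_support_left).1) hu.not_gt

theorem isConnectedNoncrossingOn_map_iff (f : β ↪o α) {G : SimpleGraph β} :
    IsConnectedNoncrossingOn (range f) (G.map f.toEmbedding) ↔
      IsConnectedNoncrossingOn univ G := by
  have hadj (x y : β) : (G.map f.toEmbedding).Adj (f x) (f y) ↔ G.Adj x y := map_adj_apply
  constructor
  · refine fun h => ⟨subset_univ _, fun p q r s hpq hqr hrs hpr hqs => ?_, fun x _ y _ => ?_⟩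
    · exact h.noncrossing (f.lt_iff_lt.mpr hpq) (f.lt_iff_lt.mpr hqr) (f.lt_iff_lt.mpr hrs)
        ((hadj p r).mpr hpr) ((hadj q s).mpr hqs)
    · have hxy := h.reachable (f x) (mem_range_self x) (f y) (mem_range_self y)
      suffices f y ∈ f '' {z | G.Reachable x z} from (f.injective.mem_set_image).mp this
      refine mem_of_reachable ?_ hxy (mem_image_of_mem f .rfl)
      rintro _ _ huv ⟨u, hu, rfl⟩
      obtain ⟨w, v, hwv, hwu, rfl⟩ := (map_adj _ _ _ _).mp huv
      rw [f.toEmbedding.injective hwu] at hwv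
      exact mem_image_of_mem f (hu.trans hwv.reachable)
  · refine fun h => ⟨?_, ?_, ?_⟩
    · exact (support_map f.toEmbedding G).trans_subset (image_subset_range f _)
    · intro p q r s hpq hqr hrs hpr hqs
      obtain ⟨p, r, hpr', rfl, rfl⟩ := (map_adj _ _ _ _).mp hpr
      obtain ⟨q, s, hqs', rfl, rfl⟩ := (map_adj _ _ _ _).mp hqs
      exact h.noncrossing (f.lt_iff_lt.mp hpq) (f.lt_iff_lt.mp hqr) (f.lt_iff_lt.mp hrs) hpr'
        hqs'
    · rintro _ ⟨x, rfl⟩ _ ⟨y, rfl⟩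
      exact (h.reachable x (mem_univ x) y (mem_univ y)).map
        (Embedding.map f.toEmbedding G).toHom

theorem setOf_isConnectedNoncrossingOn_range (f : β ↪o α) :
    {G | IsConnectedNoncrossingOn (range f) G} =
      SimpleGraph.map f.toEmbedding '' {G | IsConnectedNoncrossingOn univ G} := by
  ext G
  constructor
  · intro hG
    have hmap : (G.comap f).map f.toEmbedding = G := by
      refine le_antisymm (map_comap_le f.toEmbedding G) fun u v huv => ?_
      obtain ⟨u, rfl⟩ := hG.support_subset huv.mem_support_left
      obtain ⟨v, rfl⟩ := hG.support_subset huv.mem_support_right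
      exact map_adj_apply.mpr huv
    refine ⟨G.comap f, (isConnectedNoncrossingOn_map_iff f).mp ?_, hmap⟩
    rwa [hmap]
  · rintro ⟨G, hG, rfl⟩
    exact (isConnectedNoncrossingOn_map_iff f).mpr hG

theorem numConnectedNoncrossing_succ_eq_ncard (n : ℕ) : numConnectedNoncrossing (n + 1) =
    {G : SimpleGraph (Fin (n + 1)) | IsConnectedNoncrossingOn univ G}.ncard := by
  refine congrArg ncard (ext fun G => ⟨fun h => ?_, fun h => ⟨?_, ?_⟩⟩)
  · exact ⟨subset_univ _, fun a b c d hab hbc hcd hac hbd => h.2 a b c d hab hbc hcd ⟨hac, hbd⟩,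
      fun x _ y _ => h.1 x y⟩
  · exact ⟨fun x y => h.reachable x (mem_univ x) y (mem_univ y)⟩
  · exact fun a b c d hab hbc hcd hadj => h.noncrossing hab hbc hcd hadj.1 hadj.2

theorem exists_orderEmbedding_range_eq_Icc (m n : ℕ) :
    ∃ f : Fin (n + 1) ↪o ℕ, range f = Icc m (m + n) := by
  refine ⟨(Fin.valOrderEmb (n + 1)).trans (OrderEmbedding.addLeft m), ?_⟩
  ext x
  simp only [mem_range, mem_Icc, RelEmbedding.coe_trans, Function.comp_apply,
    Fin.valOrderEmb_apply, OrderEmbedding.addLeft_apply]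
  exact ⟨fun ⟨i, hi⟩ => by omega, fun h => ⟨⟨x - m, by omega⟩, by dsimp only; omega⟩⟩

theorem finite_setOf_isConnectedNoncrossingOn {s : Set α} (hs : s.Finite) :
    {G | IsConnectedNoncrossingOn s G}.Finite := by
  have := hs.to_subtype
  refine (finite_range fun G : SimpleGraph s => G.spanningCoe).subset fun G hG => ?_
  exact ⟨G.induce s, (spanningCoe_induce_eq_self G s).mpr hG.support_subset⟩

theorem ncard_setOf_isConnectedNoncrossingOn_Icc {l m n : ℕ} (h : l + m = n) :
    {G | IsConnectedNoncrossingOn (Icc l n) G}.ncard = numConnectedNoncrossing (m + 1) := by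
  obtain ⟨f, hf⟩ := exists_orderEmbedding_range_eq_Icc l m
  rw [← h, ← hf, setOf_isConnectedNoncrossingOn_range,
    ncard_image_of_injective _ (SimpleGraph.map_injective f.toEmbedding),
    numConnectedNoncrossing_succ_eq_ncard]

theorem ncard_biUnion_image2 {ι A B C : Type*} {I : Finset ι} {f : A → B → C} {S : ι → Set A}
    {T : ι → Set B} (hS : ∀ i ∈ I, (S i).Finite) (hT : ∀ i ∈ I, (T i).Finite)
    (hf : ∀ i ∈ I, ∀ j ∈ I, ∀ x ∈ S i, ∀ y ∈ T i, ∀ x' ∈ S j, ∀ y' ∈ T j, f x y = f x' y' →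
      i = j ∧ x = x' ∧ y = y') :
    (⋃ i ∈ I, image2 f (S i) (T i)).ncard = ∑ i ∈ I, (S i).ncard * (T i).ncard := by
  have hdisj : (I : Set ι).PairwiseDisjoint fun i => image2 f (S i) (T i) := by
    refine fun i hi j hj hij => disjoint_left.mpr ?_
    rintro _ ⟨x, hx, y, hy, rfl⟩ ⟨x', hx', y', hy', h⟩
    exact hij (hf i hi j hj x hx y hy x' hx' y' hy' h.symm).1
  have hcard (i : ι) (hi : i ∈ I) : (image2 f (S i) (T i)).ncard = (S i).ncard * (T i).ncard := by
    rw [← image_uncurry_prod, InjOn.ncard_image, ncard_prod]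
    rintro ⟨x, y⟩ ⟨hx, hy⟩ ⟨x', y'⟩ ⟨hx', hy'⟩ h
    exact Prod.ext_iff.mpr (hf i hi i hi x hx y hy x' hx' y' hy' h).2
  rw [← Finset.sum_congr rfl hcard, ← finsum_mem_coe_finset,
    ← I.finite_toSet.ncard_biUnion (fun i hi => (hS i hi).image2 f (hT i hi)) hdisj]
  simp only [Finset.mem_coe]

/-- The number of connected noncrossing graphs on `n + 2` vertices in which the first and the last
vertex are adjacent. -/
noncomputable def numWithOuterEdge (n : ℕ) : ℕ :=
  {G | IsConnectedNoncrossingOn (Icc 0 (n + 1)) G ∧ G.Adj 0 (n + 1)}.ncard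

theorem numConnectedNoncrossing_one : numConnectedNoncrossing 1 = 1 := by
  have huniv : {G : SimpleGraph (Fin 1) | IsConnectedNoncrossingOn univ G} = univ :=
    eq_univ_of_forall fun G => ⟨subset_univ _, fun a b _ _ hab => absurd hab (by omega),
      fun x _ y _ => Subsingleton.elim x y ▸ .rfl⟩
  rw [numConnectedNoncrossing_succ_eq_ncard, zero_add, huniv, ncard_univ,
    Nat.card_unique]

theorem setOf_isConnectedNoncrossingOn_Icc_eq_biUnion (n : ℕ) :
    {G | IsConnectedNoncrossingOn (Icc 0 (n + 1)) G} = ⋃ p ∈ antidiagonal n,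
      image2 (· ⊔ ·) {G | IsConnectedNoncrossingOn (Icc 0 (p.1 + 1)) G ∧ G.Adj 0 (p.1 + 1)}
        {G | IsConnectedNoncrossingOn (Icc (p.1 + 1) (n + 1)) G} := by
  ext G
  simp only [mem_iUnion, HasAntidiagonal.mem_antidiagonal, Prod.exists, exists_prop]
  constructor
  · intro hG
    obtain ⟨c, ⟨hc0, hcn⟩, G₁, G₂, hG₁, hG₂, rfl⟩ := hG.exists_eq_sup n.succ_pos
    obtain ⟨i, rfl⟩ := Nat.exists_eq_add_of_le' hc0
    exact ⟨i, n - i, by omega, mem_image2_of_mem hG₁ hG₂⟩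
  · rintro ⟨i, j, rfl, G₁, ⟨hG₁, -⟩, G₂, hG₂, rfl⟩
    have h := hG₁.sup hG₂ (c := i + 1) (fun x hx y hy => hx.2.trans hy.1) (by simp) (by simp)
    rwa [Icc_union_Icc_eq_Icc (by omega) (by omega)] at h

theorem numConnectedNoncrossing_add_two (n : ℕ) : numConnectedNoncrossing (n + 2) =
    ∑ p ∈ antidiagonal n, numWithOuterEdge p.1 * numConnectedNoncrossing (p.2 + 1) := by
  rw [← ncard_setOf_isConnectedNoncrossingOn_Icc (zero_add (n + 1)),
    setOf_isConnectedNoncrossingOn_Icc_eq_biUnion, ncard_biUnion_image2]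
  · refine Finset.sum_congr rfl fun p hp => ?_
    rw [HasAntidiagonal.mem_antidiagonal] at hp
    rw [numWithOuterEdge,
      ncard_setOf_isConnectedNoncrossingOn_Icc (show p.1 + 1 + p.2 = n + 1 by omega)]
  · exact fun p _ => (finite_setOf_isConnectedNoncrossingOn (finite_Icc _ _)).subset fun G h => h.1
  · exact fun p _ => finite_setOf_isConnectedNoncrossingOn (finite_Icc _ _)
  rintro ⟨i, j⟩ hij ⟨i', j'⟩ hij' G₁ ⟨hG₁, hadj⟩ G₂ hG₂ G₁' ⟨hG₁', hadj'⟩ G₂' hG₂' h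
  rw [HasAntidiagonal.mem_antidiagonal] at hij hij'
  dsimp only at *
  have hgreatest' := hG₁'.isGreatest_neighborSet_sup hadj' hG₂'
  rw [← h] at hgreatest'
  obtain rfl : i = i' :=
    Nat.succ_injective ((hG₁.isGreatest_neighborSet_sup hadj hG₂).unique hgreatest')
  obtain rfl : j = j' := by omega
  refine ⟨rfl, eq_and_eq_of_sup_eq_sup hG₁.support_subset hG₂.support_subset hG₁'.support_subset
    hG₂'.support_subset ?_ h⟩
  rw [Icc_inter_Icc_eq_singleton (by omega) (by omega)]
  exact subsingleton_singleton

/-- The graphs obtained by placing connected noncrossing graphs side by side on an initial segment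
`{0, …, i}` and on the complementary segment `{i + 1, …, n + 1}`. -/
def splitGraphs (n : ℕ) : Set (SimpleGraph ℕ) :=
  ⋃ p ∈ antidiagonal n, image2 (· ⊔ ·) {G | IsConnectedNoncrossingOn (Icc 0 p.1) G}
    {G | IsConnectedNoncrossingOn (Icc (p.1 + 1) (n + 1)) G}

theorem mem_splitGraphs_iff {n : ℕ} {G : SimpleGraph ℕ} : G ∈ splitGraphs n ↔
    ∃ i ≤ n, ∃ G₁ G₂, IsConnectedNoncrossingOn (Icc 0 i) G₁ ∧
      IsConnectedNoncrossingOn (Icc (i + 1) (n + 1)) G₂ ∧ G = G₁ ⊔ G₂ := by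
  simp only [splitGraphs, mem_iUnion, HasAntidiagonal.mem_antidiagonal, Prod.exists, exists_prop]
  constructor
  · rintro ⟨i, j, rfl, G₁, hG₁, G₂, hG₂, rfl⟩
    exact ⟨i, i.le_add_right j, G₁, G₂, hG₁, hG₂, rfl⟩
  · rintro ⟨i, hi, G₁, G₂, hG₁, hG₂, rfl⟩
    exact ⟨i, n - i, Nat.add_sub_cancel' hi, mem_image2_of_mem hG₁ hG₂⟩

theorem finite_splitGraphs (n : ℕ) : (splitGraphs n).Finite :=
  (antidiagonal n).finite_toSet.biUnion fun _ _ =>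
    (finite_setOf_isConnectedNoncrossingOn (finite_Icc _ _)).image2 _
      (finite_setOf_isConnectedNoncrossingOn (finite_Icc _ _))

theorem not_reachable_of_mem_splitGraphs {n : ℕ} {G : SimpleGraph ℕ} (hG : G ∈ splitGraphs n) :
    ¬ G.Reachable 0 (n + 1) := by
  obtain ⟨i, hi, G₁, G₂, hG₁, hG₂, rfl⟩ := mem_splitGraphs_iff.mp hG
  intro h
  have := (hG₁.isGreatest_reachable_sup i.zero_le hG₂ i.lt_succ_self).2 h
  omega

theorem ncard_splitGraphs (n : ℕ) : (splitGraphs n).ncard = ∑ p ∈ antidiagonal n,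
    numConnectedNoncrossing (p.1 + 1) * numConnectedNoncrossing (p.2 + 1) := by
  rw [splitGraphs, ncard_biUnion_image2]
  · refine Finset.sum_congr rfl fun p hp => ?_
    rw [HasAntidiagonal.mem_antidiagonal] at hp
    rw [ncard_setOf_isConnectedNoncrossingOn_Icc (zero_add p.1),
      ncard_setOf_isConnectedNoncrossingOn_Icc (show p.1 + 1 + p.2 = n + 1 by omega)]
  · exact fun p _ => finite_setOf_isConnectedNoncrossingOn (finite_Icc _ _)
  · exact fun p _ => finite_setOf_isConnectedNoncrossingOn (finite_Icc _ _)
  rintro ⟨i, j⟩ hij ⟨i', j'⟩ hij' G₁ hG₁ G₂ hG₂ G₁' hG₁' G₂' hG₂' h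
  rw [HasAntidiagonal.mem_antidiagonal] at hij hij'
  dsimp only at *
  have hgreatest' := hG₁'.isGreatest_reachable_sup i'.zero_le hG₂' i'.lt_succ_self
  rw [← h] at hgreatest'
  obtain rfl : i = i' :=
    (hG₁.isGreatest_reachable_sup i.zero_le hG₂ i.lt_succ_self).unique hgreatest'
  obtain rfl : j = j' := by omega
  refine ⟨rfl, eq_and_eq_of_sup_eq_sup hG₁.support_subset hG₂.support_subset hG₁'.support_subset
    hG₂'.support_subset (fun x hx => ?_) h⟩
  exact absurd (hx.1.2.trans_lt i.lt_succ_self) hx.2.1.not_gt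

theorem setOf_adj_eq_image_sup_edge (n : ℕ) :
    {G | IsConnectedNoncrossingOn (Icc 0 (n + 1)) G ∧ G.Adj 0 (n + 1)} = (· ⊔ edge 0 (n + 1)) ''
      ({G | IsConnectedNoncrossingOn (Icc 0 (n + 1)) G ∧ ¬ G.Adj 0 (n + 1)} ∪ splitGraphs n) := by
  have hedge : (edge 0 (n + 1)).Adj 0 (n + 1) := by simp [edge_adj]
  ext G
  constructor
  · rintro ⟨hG, hadj⟩
    have hsup : G \ edge 0 (n + 1) ⊔ edge 0 (n + 1) = G :=
      sdiff_sup_cancel (by simp [hadj])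
    refine ⟨G \ edge 0 (n + 1), or_iff_not_imp_left.mpr fun hnot => ?_, hsup⟩
    rw [← hsup] at hG
    obtain ⟨c, d, -, hcd, hdn, G₁, G₂, hG₁, hG₂, heq⟩ :=
      hG.exists_eq_sup_of_sup_edge (n + 1).zero_le fun h => hnot ⟨h, fun h' => h'.2 hedge⟩
    obtain rfl := Order.covBy_iff_add_one_eq.mp hcd
    exact mem_splitGraphs_iff.mpr ⟨c, by omega, G₁, G₂, hG₁, hG₂, heq⟩
  · rintro ⟨G, ⟨hG, -⟩ | hG, rfl⟩
    · exact ⟨hG.sup_edge n.succ_pos, .inr hedge⟩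
    · obtain ⟨i, hi, G₁, G₂, hG₁, hG₂, rfl⟩ := mem_splitGraphs_iff.mp hG
      exact ⟨hG₁.sup_sup_edge hG₂ i.zero_le (Order.covBy_add_one i) (by omega), .inr hedge⟩

theorem two_mul_numWithOuterEdge (n : ℕ) : 2 * numWithOuterEdge n =
    numConnectedNoncrossing (n + 2) + ∑ p ∈ antidiagonal n,
      numConnectedNoncrossing (p.1 + 1) * numConnectedNoncrossing (p.2 + 1) := by
  rw [← ncard_splitGraphs, ← ncard_setOf_isConnectedNoncrossingOn_Icc (zero_add (n + 1))]
  have hfin := finite_setOf_isConnectedNoncrossingOn (finite_Icc 0 (n + 1))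
  have hpart := ncard_inter_add_ncard_sdiff_eq_ncard _ {G | G.Adj 0 (n + 1)} hfin
  have hdisj : Disjoint {G | IsConnectedNoncrossingOn (Icc 0 (n + 1)) G ∧ ¬ G.Adj 0 (n + 1)}
      (splitGraphs n) := disjoint_left.mpr fun G hG hsplit =>
    not_reachable_of_mem_splitGraphs hsplit (hG.1.reachable _ (by simp) _ (by simp))
  have hinj : InjOn (· ⊔ edge 0 (n + 1))
      ({G | IsConnectedNoncrossingOn (Icc 0 (n + 1)) G ∧ ¬ G.Adj 0 (n + 1)} ∪ splitGraphs n) := by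
    refine injOn_sup_edge.mono ?_
    rintro G (hG | hG)
    · exact hG.2
    · exact fun hadj => not_reachable_of_mem_splitGraphs hG hadj.reachable
  have hcount : numWithOuterEdge n =
      {G | IsConnectedNoncrossingOn (Icc 0 (n + 1)) G ∧ ¬ G.Adj 0 (n + 1)}.ncard +
        (splitGraphs n).ncard := by
    rw [numWithOuterEdge, setOf_adj_eq_image_sup_edge, hinj.ncard_image,
      ncard_union_eq hdisj (hfin.subset fun G hG => hG.1) (finite_splitGraphs n)]
  change numWithOuterEdge n +
    {G | IsConnectedNoncrossingOn (Icc 0 (n + 1)) G ∧ ¬ G.Adj 0 (n + 1)}.ncard = _ at hpart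
  omega

end Counting

end Graphs

section GeneratingFunctions

open PowerSeries

/-- The generating function of connected noncrossing graphs, in which `X` marks the vertices other
than the first one. -/
noncomputable def connGF : ℚ⟦X⟧ := mk fun n => (numConnectedNoncrossing (n + 1) : ℚ)

/-- The generating function of connected noncrossing graphs containing the outer edge, in which `X`
marks the vertices other than the first and the last one. -/
noncomputable def outerEdgeGF : ℚ⟦X⟧ := mk fun n => (numWithOuterEdge n : ℚ)

theorem constantCoeff_connGF : constantCoeff connGF = 1 := by
  rw [← coeff_zero_eq_constantCoeff_apply, connGF, coeff_mk, zero_add,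
    numConnectedNoncrossing_one, Nat.cast_one]

theorem connGF_eq_one_add : connGF = 1 + X * (outerEdgeGF * connGF) := by
  ext (_ | n)
  · simp [constantCoeff_connGF]
  · rw [map_add, coeff_succ_X_mul, coeff_mul, coeff_one, if_neg n.succ_ne_zero, zero_add]
    simp only [connGF, outerEdgeGF, coeff_mk]
    exact_mod_cast numConnectedNoncrossing_add_two n

theorem two_mul_X_mul_outerEdgeGF :
    2 * (X * outerEdgeGF) = connGF - 1 + X * (connGF * connGF) := by
  ext (_ | n)
  · simp [constantCoeff_connGF]
  · rw [← map_ofNat C 2, coeff_C_mul, map_add, map_sub, coeff_succ_X_mul, coeff_succ_X_mul,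
      coeff_mul, coeff_one, if_neg n.succ_ne_zero, sub_zero]
    simp only [connGF, outerEdgeGF, coeff_mk]
    have h := congrArg (Nat.cast : ℕ → ℚ) (two_mul_numWithOuterEdge n)
    push_cast at h
    exact h

theorem connGF_cubic : X * connGF ^ 3 + connGF ^ 2 - 3 * connGF + 2 = 0 := by
  linear_combination (-2) * connGF_eq_one_add - connGF * two_mul_X_mul_outerEdgeGF

end GeneratingFunctions

end NoncrossingGraph

open NoncrossingGraph

theorem mainTheorem4 (n : ℕ) (hn : 1 ≤ n) :
    (numConnectedNoncrossing n : ℚ) =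
      (2 : ℚ) ^ (2 * n - 1) / (n : ℚ) * Ring.choose (3 * (n : ℚ) / 2 - 2) (n - 1) -
        (2 : ℚ) ^ (2 * n - 2) / (n : ℚ) * Ring.choose (3 * (n : ℚ) / 2 - 3 / 2) (n - 1) := by
  obtain ⟨k, rfl⟩ := Nat.exists_eq_add_of_le' hn
  have h := succ_mul_coeff_of_cubic connGF_cubic constantCoeff_connGF k
  rw [connGF, PowerSeries.coeff_mk] at h
  have hfour : (4 : ℚ) ^ (k + 1) = 4 * 2 ^ (2 * k) := by rw [pow_succ', pow_mul]; norm_num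
  rw [hfour] at h
  rw [show 2 * (k + 1) - 1 = 2 * k + 1 by omega, show 2 * (k + 1) - 2 = 2 * k by omega,
    Nat.add_sub_cancel]
  push_cast
  rw [show 3 * ((k : ℚ) + 1) / 2 - 2 = 3 * k / 2 - 1 / 2 by ring,
    show 3 * ((k : ℚ) + 1) / 2 - 3 / 2 = 3 * k / 2 by ring]
  generalize Ring.choose (3 * (k : ℚ) / 2 - 1 / 2) k = A at h ⊢
  generalize Ring.choose (3 * (k : ℚ) / 2) k = B at h ⊢
  field_simp
  linear_combination h / 2
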